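/- A plane tree with $e\ge 1$ edges is a triple $(H,\alpha,\sigma)$, where $H$ is a set of $2e$ half-edges and $\alpha,\sigma$ are permutations of $H$ such that $\alpha$ is a fixed-point-free involution, the group generated by $\alpha$ and $\sigma$ acts transitively on $H$, and $\sigma$ has exactly $e+1$ cycles (fixed points included). The cycles of $\sigma$ are the vertices, and the length of a cycle is the degree of the vertex. An $N$-rooted plane tree is a plane tree with an ordered choice of $N$ half-edges $r_1,\dots,r_N$ (the roots) lying in $N$ distinct cycles of $\sigma$ (the root vertices). Two $N$-rooted plane trees are identified if a bijection of their half-edges carries $\alpha$ to $\alpha'$, $\sigma$ to $\sigma'$ and $r_k$ to $r'_k$ for every $k$. In addition, the graph with one vertex and no edges counts as a $1$-rooted plane tree with $e=0$ and root vertex of degree $0$. For $N\ge 1$ let $T_N(e;d_1,\dots,d_N)$ be the number of $N$-rooted plane trees with $e$ edges in which the $k$-th root vertex has degree $d_k$ for $k=1,\dots,N$. **Theorem.** Let $e\ge 1$, $1\le N\le e+1$, and let $d_1,\dots,d_N$ be positive integers with $\sum_{i=1}^N d_i\le e+N-1$, such that $N=e+1$ if and only if $\sum_{i=1}^N d_i=2e$.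 Then $$T_N(e;d_1,\dots,d_N)=\frac{(e-1)!}{(e+1-N)!}\binom{2e-1-\sum_{i=1}^N d_i}{e-N}\prod_{j=1}^N d_j ,$$ with the convention $\binom{-1}{-1}=1$ (which is used exactly when $N=e+1$). For $e=0$ the only non-zero value is $T_1(0;0)=1$. -/

import Mathlib

namespace MultiRooted

/-- A plane tree with `e ≥ 1` edges on the half-edges `h₁, …, h₂ₑ`: `α` pairs half-edges into edges,
the cycles of `σ` (fixed points included) are the vertices with the cyclic order around them.
There is no such datum for `e = 0`, since then `σ` has no cycles at all; the one-vertex tree is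
added separately below. -/
structure PlaneTree (e : ℕ) where
  /-- the edge involution -/
  α : Equiv.Perm (Fin (2 * e))
  /-- the vertex permutation -/
  σ : Equiv.Perm (Fin (2 * e))
  involutive : ∀ h, α (α h) = h
  fixedPointFree : ∀ h, α h ≠ h
  transitive : MulAction.IsPretransitive
    (Subgroup.closure ({α, σ} : Set (Equiv.Perm (Fin (2 * e))))) (Fin (2 * e))
  card_vertices : Nat.card (Quotient (Equiv.Perm.SameCycle.setoid σ)) = 1 + e

/-- The degree of the vertex to which the half-edge `h` is attached: the length of the cycle of `σ`
through `h`. -/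
noncomputable def PlaneTree.degreeAt {e : ℕ} (Γ : PlaneTree e) (h : Fin (2 * e)) : ℕ :=
  Nat.card {h' : Fin (2 * e) // Γ.σ.SameCycle h h'}

/-- An `N`-rooted plane tree with `e` edges: a plane tree with `N` labelled half-edges (the roots) at
`N` distinct vertices, or, exceptionally, for `N = 1` and `e = 0`, the tree consisting of a single
vertex and no edges. -/
inductive RootedTree (N e : ℕ) : Type
  | singleVertex (hN : N = 1) (he : e = 0) : RootedTree N e
  | ofPlaneTree (Γ : PlaneTree e) (root : Fin N → Fin (2 * e))
      (distinct : ∀ i j, i ≠ j → ¬ Γ.σ.SameCycle (root i) (root j)) : RootedTree N e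

namespace RootedTree

variable {N e : ℕ}

/-- The degree of the root vertex labelled `i`. -/
noncomputable def degree : RootedTree N e → Fin N → ℕ
  | singleVertex _ _, _ => 0
  | ofPlaneTree Γ root _, i => Γ.degreeAt (root i)

/-- Isomorphism of `N`-rooted plane trees: a bijection of the half-edges that intertwines the
permutations `α` and `σ` and sends the `k`-th root to the `k`-th root. -/
def Iso : RootedTree N e → RootedTree N e → Prop
  | singleVertex _ _, singleVertex _ _ => True
  | ofPlaneTree Γ r _, ofPlaneTree Γ' r' _ =>
      ∃ φ : Equiv.Perm (Fin (2 * e)),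
        (∀ h, φ (Γ.α h) = Γ'.α (φ h)) ∧ (∀ h, φ (Γ.σ h) = Γ'.σ (φ h)) ∧ ∀ k, φ (r k) = r' k
  | _, _ => False

theorem Iso.refl (t : RootedTree N e) : Iso t t := by
  cases t with
  | singleVertex => trivial
  | ofPlaneTree Γ r h => exact ⟨1, by simp⟩

theorem Iso.symm {s t : RootedTree N e} (h : Iso s t) : Iso t s := by
  cases s <;> cases t <;> try trivial
  obtain ⟨φ, h1, h2, h3⟩ := h
  refine ⟨φ.symm, fun x => ?_, fun x => ?_, fun k => ?_⟩
  · rw [Equiv.symm_apply_eq, h1, Equiv.apply_symm_apply]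
  · rw [Equiv.symm_apply_eq, h2, Equiv.apply_symm_apply]
  · rw [Equiv.symm_apply_eq, h3]

theorem Iso.trans {s t u : RootedTree N e} (h : Iso s t) (h' : Iso t u) : Iso s u := by
  cases s <;> cases t <;> cases u <;> try trivial
  obtain ⟨φ, h1, h2, h3⟩ := h
  obtain ⟨ψ, k1, k2, k3⟩ := h'
  exact ⟨φ.trans ψ, fun x => by simp [h1, k1], fun x => by simp [h2, k2],
    fun k => by simp [h3, k3]⟩

end RootedTree

/-- Isomorphism on the `N`-rooted plane trees with `e` edges whose root vertices have the degrees
`d 0, …, d (N - 1)`. -/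
def isoSetoid (N e : ℕ) (d : Fin N → ℕ) : Setoid {t : RootedTree N e // ∀ i, t.degree i = d i} where
  r s t := RootedTree.Iso s.1 t.1
  iseqv := ⟨fun s => RootedTree.Iso.refl s.1, fun h => h.symm, fun h h' => h.trans h'⟩

/-- `T_N(e; d₁, …, d_N)`: the number of `N`-rooted plane trees, up to isomorphism, with `e` edges and
degrees `d₁, …, d_N` of the ordered root vertices. -/
noncomputable def T (N e : ℕ) (d : Fin N → ℕ) : ℕ :=
  Nat.card (Quotient (isoSetoid N e d))

/-- The binomial coefficient with integer entries: `a (a - 1) ⋯ (a - b + 1) / b!` for `b ≥ 0`, the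
convention `C(-1, -1) = 1`, and zero for all other negative `b`. -/
def binom (a b : ℤ) : ℤ :=
  if 0 ≤ b then Ring.choose a b.toNat else if a = -1 ∧ b = -1 then 1 else 0

end MultiRooted

/-! Root every vertex first. When N = e + 1, the roots give each half-edge a canonical name (vertex,
distance from the root along σ), so no automorphisms remain and a tree is just a pairing of the
half-edges in `Σ i, Fin (d i)` that connects the e + 1 vertices. There are (e - 1)! ∏ dᵢ of these
when ∑ dᵢ = 2e (`card_connectedPairing`, by removing a leaf), and none otherwise (`T_succ_self`).

Then forget roots. An unrooted vertex of degree k can receive the next root in k ways, so weighting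
the new root by 1/k counts each of the e + 1 - N unrooted vertices once
(`sum_card_labelledTree_cons`). Descending from N = e + 1, the weight 1/k cancels the new factor k
in the product of degrees. With m = e + 1 - N this gives m! T = (e - 1)! ∏ dᵢ · c, where c counts
the ways to split 2e - ∑ dᵢ into m positive degrees, a binomial coefficient.

The recursion is run on trees with labelled half-edges. Already one root makes relabelling free, so
they number (2e)! T (`card_labelledTree`). -/

namespace MultiRooted

/-! ### Connected pairings and leaf removal -/

/-- A pairing `α` of the half-edges `H`, attached to the vertices `V` by `f`, for which the
resulting graph is connected. -/
structure IsConnectedPairing {H V : Type} (f : H → V) (α : H → H) : Prop where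
  involutive : ∀ h, α (α h) = h
  ne_self : ∀ h, α h ≠ h
  connected : ∀ p : V → Prop, (∀ h, p (f h) → p (f (α h))) → ∀ u v, p u → p v

/-- The attaching map after a leaf `i` with half-edge `a` and the partner `b` of `a` are removed. -/
def removeLeaf {H V : Type} (f : H → V) {i : V} {a : H} (ha : ∀ h, f h = i → h = a) (b : H) :
    {h : H // h ≠ a ∧ h ≠ b} → {v : V // v ≠ i} :=
  fun h => ⟨f h, fun hi => h.2.1 (ha h hi)⟩

open Classical in
/-- Connected pairings which match the half-edge `a` of a leaf `i` with `b` correspond to connected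
pairings after the removal of the leaf. -/
noncomputable def removeLeafEquiv {H V : Type} (f : H → V) {i : V} {a : H} (hi : f a = i)
    (ha : ∀ h, f h = i → h = a) {b : H} (hb : b ≠ a) :
    {α : {α : H → H // IsConnectedPairing f α} // α.1 a = b} ≃
      {α // IsConnectedPairing (removeLeaf f ha b) α} where
  toFun α := ⟨fun h => ⟨α.1.1 h, fun h1 => h.2.2 (by
      rw [← α.1.2.involutive h, h1, α.2]), fun h1 => h.2.1
      ((α.1.2.involutive h).symm.trans
        ((congrArg α.1.1 (h1.trans α.2.symm)).trans (α.1.2.involutive a)))⟩, by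
    obtain ⟨⟨α, hα⟩, hab⟩ := α
    dsimp only at hab ⊢
    have hba : α b = a := by rw [← hab, hα.involutive]
    have hfb : f b ≠ i := fun h => hb (ha b h)
    refine ⟨fun h => Subtype.ext (hα.involutive h),
      fun h hh => hα.ne_self h (congrArg Subtype.val hh), fun p hp u v hu => ?_⟩
    -- The leaf inherits the value of `p` at its only neighbour `f b`.
    have := hα.connected (fun w => if hw : w = i then p ⟨f b, hfb⟩ else p ⟨w, hw⟩) ?_ u v
    · simpa [u.2, v.2, hu] using this
    · intro h
      by_cases h1 : h = a
      · subst h1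
        simp [hi, hab, hfb]
      by_cases h2 : h = b
      · subst h2
        simp [hi, hba, hfb]
      have h3 : f h ≠ i := fun h' => h1 (ha _ h')
      have h4 : f (α h) ≠ i := fun h' => h2 (by
        rw [← hα.involutive h, ha _ h', hab])
      simpa [h3, h4, removeLeaf] using hp ⟨h, h1, h2⟩⟩
  invFun α := ⟨⟨fun h => if h1 : h = a then b else if h2 : h = b then a else α.1 ⟨h, h1, h2⟩, by
    obtain ⟨α, hα⟩ := α
    refine ⟨fun h => ?_, fun h => ?_, fun p hp u v hu => ?_⟩
    · by_cases h1 : h = a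
      · simp [h1, hb]
      by_cases h2 : h = b
      · simp [h2, hb]
      simp [h1, h2, (α ⟨h, h1, h2⟩).2.1, (α ⟨h, h1, h2⟩).2.2, hα.involutive]
    · by_cases h1 : h = a
      · simp [h1, hb]
      by_cases h2 : h = b
      · simp [h2, hb, hb.symm]
      simp only [h1, h2, dite_false]
      exact fun h3 => hα.ne_self ⟨h, h1, h2⟩ (Subtype.ext h3)
    · have hfb : f b ≠ i := fun h => hb (ha b h)
      have hab : p i ↔ p (f b) := by
        have h1 := hp a
        have h2 := hp b
        simp [hb, hi] at h1 h2
        exact ⟨h1, h2⟩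
      have key : ∀ x y : {v // v ≠ i}, p x → p y := by
        refine hα.connected (fun w => p w) fun h => ?_
        simpa [h.2.1, h.2.2, removeLeaf] using hp h
      -- Replacing the leaf by its neighbour reduces connectivity to the remaining vertices.
      have lift : ∀ w, p w ↔ p (if w = i then f b else w) := by
        intro w
        split_ifs with hw
        · rw [hw, hab]
        · rfl
      have ne : ∀ w, (if w = i then f b else w) ≠ i := by
        intro w
        split_ifs with hw
        · exact hfb
        · exact hw
      rw [lift] at hu ⊢
      exact key ⟨_, ne u⟩ ⟨_, ne v⟩ hu⟩, by simp⟩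
  left_inv α := by
    obtain ⟨⟨α, hα⟩, hab⟩ := α
    dsimp only at hab
    ext h
    by_cases h1 : h = a
    · simp [h1, hab]
    by_cases h2 : h = b
    · have hba : α b = a := by rw [← hab, hα.involutive]
      simp [h2, hb, hba]
    simp [h1, h2]
  right_inv α := by
    ext h
    simp [h.2.1, h.2.2]


theorem card_removeLeaf_fiber {H V : Type} [Finite H] [DecidableEq V] (f : H → V) {i : V} {a : H}
    (hi : f a = i) (ha : ∀ h, f h = i → h = a) (b : H) (v : {v : V // v ≠ i}) :
    Nat.card {h // removeLeaf f ha b h = v} =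
      Nat.card {h // f h = v} - if f b = v then 1 else 0 := by
  classical
  have := Fintype.ofFinite H
  have e1 : Nat.card {h // removeLeaf f ha b h = v} =
      ((Finset.univ.filter fun h => f h = v).erase b).card := by
    rw [← Fintype.card_coe, ← Nat.card_eq_fintype_card]
    refine Nat.card_congr ((Equiv.subtypeSubtypeEquivSubtypeExists _ _).trans
      (Equiv.subtypeEquivRight fun h => ?_))
    simp only [removeLeaf, Subtype.ext_iff, Finset.mem_erase, Finset.mem_filter_univ]
    exact ⟨fun ⟨h1, h2⟩ => ⟨h1.2, h2⟩, fun ⟨h1, h2⟩ =>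
      ⟨⟨fun h3 => v.2 (h2.symm.trans ((congrArg f h3).trans hi)), h1⟩, h2⟩⟩
  rw [e1, Finset.card_erase_eq_ite, Nat.card_eq_fintype_card, Fintype.card_subtype]
  simp only [Finset.mem_filter_univ]
  split_ifs <;> simp

theorem sum_card_fiber {H V : Type} [Finite H] [Fintype V] (f : H → V) :
    ∑ v, Nat.card {h // f h = v} = Nat.card H := by
  rw [← Nat.card_sigma]
  exact Nat.card_congr (Equiv.sigmaFiberEquiv f)

theorem sum_comp_eq_sum_card_fiber {H V R : Type} [Fintype H] [Fintype V] [AddCommMonoid R]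
    (f : H → V) (Q : V → R) : ∑ h, Q (f h) = ∑ v, Nat.card {h // f h = v} • Q v := by
  classical
  rw [← Finset.sum_fiberwise (s := Finset.univ) (g := f)]
  refine Finset.sum_congr rfl fun v _ => ?_
  rw [Finset.sum_congr rfl (g := fun _ => Q v) (by simp +contextual), Finset.sum_const,
    Nat.card_eq_fintype_card, Fintype.card_subtype]

theorem card_connectedPairing_of_fiber_eq_zero {H V : Type} [Finite V] [Nontrivial V] (f : H → V)
    {v : V} [Finite H] (hv : Nat.card {h // f h = v} = 0) :
    Nat.card {α // IsConnectedPairing f α} = 0 := by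
  have hv' : ∀ h, f h ≠ v := by
    intro h hh
    have : Nonempty {h // f h = v} := ⟨⟨h, hh⟩⟩
    exact Nat.card_pos.ne' hv
  have : IsEmpty {α // IsConnectedPairing f α} := by
    refine ⟨fun α => ?_⟩
    obtain ⟨w, hw⟩ := exists_ne v
    exact hw (α.2.connected (· = v) (fun h hh => (hv' h hh).elim) v w rfl)
  exact Nat.card_of_isEmpty

/-- Sort the pairings by the partner `b` of the leaf's half-edge. -/
theorem card_connectedPairing_eq_sum_removeLeaf {H V : Type} [Fintype H] [DecidableEq H]
    (f : H → V) {i : V} {a : H} (hi : f a = i) (ha : ∀ h, f h = i → h = a) :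
    Nat.card {α // IsConnectedPairing f α} =
      ∑ b : {b // b ≠ a}, Nat.card {α // IsConnectedPairing (removeLeaf f ha b) α} := by
  rw [← Finset.sum_congr rfl
    fun (b : {b // b ≠ a}) _ => Nat.card_congr (removeLeafEquiv f hi ha b.2), ← Nat.card_sigma]
  let g : {α // IsConnectedPairing f α} → {b // b ≠ a} := fun α => ⟨α.1 a, α.2.ne_self a⟩
  refine (Nat.card_congr ((Equiv.sigmaCongrRight fun b => Equiv.subtypeEquivRight fun α => ?_).trans
    (Equiv.sigmaFiberEquiv g))).symm
  exact ⟨fun h => Subtype.ext h, fun h => congrArg Subtype.val h⟩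

/-- The degrees sum to 2n + 2, less than twice the number n + 2 of vertices, so they cannot all be
at least 2. -/
theorem exists_leaf {H V : Type} [Finite H] [Fintype V] (f : H → V) {n : ℕ}
    (hV : Nat.card V = n + 2) (hH : Nat.card H = 2 * (n + 1))
    (hf : ∀ v, Nat.card {h // f h = v} ≠ 0) : ∃ a, ∀ h, f h = f a → h = a := by
  obtain ⟨i, hi⟩ : ∃ i, Nat.card {h // f h = i} = 1 := by
    by_contra! hne
    have h1 : ∑ _v : V, 2 ≤ ∑ v, Nat.card {h // f h = v} :=
      Finset.sum_le_sum fun v _ => by have := hf v; have := hne v; omega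
    rw [sum_card_fiber, hH, Finset.sum_const, Finset.card_univ, ← Nat.card_eq_fintype_card, hV,
      smul_eq_mul] at h1
    omega
  obtain ⟨⟨a, ha⟩, hu⟩ := (Nat.card_eq_one_iff_exists).1 hi
  exact ⟨a, fun h hh => congrArg Subtype.val (hu ⟨h, hh.trans ha⟩)⟩

theorem card_ne_eq {X : Type} [Finite X] (a : X) {n : ℕ} (h : Nat.card X = n + 1) :
    Nat.card {x // x ≠ a} = n := by
  classical
  have := Fintype.ofFinite X
  rw [Nat.card_eq_fintype_card] at h ⊢
  rw [Fintype.card_subtype_compl, h, Fintype.card_subtype_eq, Nat.add_sub_cancel]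

theorem card_ne_ne_eq {X : Type} [Finite X] {a b : X} (hb : b ≠ a) {n : ℕ}
    (h : Nat.card X = n + 2) : Nat.card {x // x ≠ a ∧ x ≠ b} = n := by
  rw [← card_ne_eq (⟨b, hb⟩ : {x // x ≠ a}) (card_ne_eq a h)]
  exact Nat.card_congr (((Equiv.subtypeEquivRight fun x => by simp [Subtype.ext_iff]).trans
    (Equiv.subtypeSubtypeEquivSubtypeInter (fun x => x ≠ a) (fun x => x ≠ b))).symm)

theorem card_connectedPairing_of_isEmpty {H V : Type} [IsEmpty H] [Subsingleton V] (f : H → V) :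
    Nat.card {α // IsConnectedPairing f α} = 1 := by
  have : Unique {α // IsConnectedPairing f α} :=
    { default := ⟨isEmptyElim, isEmptyElim, isEmptyElim,
        fun p _ u v hu => Subsingleton.elim u v ▸ hu⟩
      uniq := fun α => Subtype.ext (funext isEmptyElim) }
  exact Nat.card_unique

/-- The number of connected pairings, when the graph is to be a tree. -/
theorem card_connectedPairing (n : ℕ) : ∀ {H V : Type} [Finite H] [Fintype V] (f : H → V),
    Nat.card V = n + 2 → Nat.card H = 2 * (n + 1) →
      Nat.card {α // IsConnectedPairing f α} = n.factorial * ∏ v, Nat.card {h // f h = v} := by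
  classical
  induction n with
  | zero =>
    intro H V _ _ f hV hH
    have := Fintype.ofFinite H
    have : Nontrivial V := Finite.one_lt_card_iff_nontrivial.1 (by omega)
    by_cases hf : ∃ v, Nat.card {h // f h = v} = 0
    · obtain ⟨v, hv⟩ := hf
      rw [card_connectedPairing_of_fiber_eq_zero f hv, Finset.prod_eq_zero (Finset.mem_univ v) hv,
        mul_zero]
    push Not at hf
    obtain ⟨a, ha⟩ := exists_leaf f hV hH hf
    -- Two positive degrees with sum two are both one.
    have h1 : ∀ v, 1 = Nat.card {h // f h = v} := by
      have h2 : ∑ _v : V, 1 = ∑ v, Nat.card {h // f h = v} := by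
        rw [sum_card_fiber, hH, Finset.sum_const, Finset.card_univ, ← Nat.card_eq_fintype_card, hV]
        rfl
      have := (Finset.sum_eq_sum_iff_of_le fun v _ => Nat.one_le_iff_ne_zero.2 (hf v)).1 h2
      exact fun v => this v (Finset.mem_univ v)
    rw [card_connectedPairing_eq_sum_removeLeaf f rfl ha, Finset.prod_eq_one fun v _ => (h1 v).symm,
      Finset.sum_congr rfl (g := fun _ => 1), Finset.sum_const, Finset.card_univ,
      ← Nat.card_eq_fintype_card, card_ne_eq a hH]
    · rfl
    intro b _
    have : IsEmpty {h // h ≠ a ∧ h ≠ b.1} := (Finite.card_eq_zero_iff).1 (card_ne_ne_eq b.2 hH)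
    have : Subsingleton {v // v ≠ f a} := Finite.card_le_one_iff_subsingleton.1
      (card_ne_eq (f a) hV).le
    exact card_connectedPairing_of_isEmpty _
  | succ n ih =>
    intro H V _ _ f hV hH
    have := Fintype.ofFinite H
    have : Nontrivial V := Finite.one_lt_card_iff_nontrivial.1 (by omega)
    by_cases hf : ∃ v, Nat.card {h // f h = v} = 0
    · obtain ⟨v, hv⟩ := hf
      rw [card_connectedPairing_of_fiber_eq_zero f hv, Finset.prod_eq_zero (Finset.mem_univ v) hv,
        mul_zero]
    push Not at hf
    obtain ⟨a, ha⟩ := exists_leaf f hV hH hf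
    have hV' := card_ne_eq (f a) hV
    have hH' := card_ne_eq a (n := 2 * n + 3) hH
    set D : V → ℕ := fun v => Nat.card {h // f h = v} with hD
    have hDa : D (f a) = 1 :=
      Nat.card_eq_one_iff_exists.2 ⟨⟨a, rfl⟩, fun h => Subtype.ext (ha _ h.2)⟩
    let g : {b // b ≠ a} → {v // v ≠ f a} := fun b => ⟨f b, fun h => b.2 (ha b h)⟩
    have hg : ∀ v : {v // v ≠ f a}, Nat.card {b // g b = v} = D v := by
      intro v
      refine Nat.card_congr ((Equiv.subtypeSubtypeEquivSubtypeExists _ _).trans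
        (Equiv.subtypeEquivRight fun h => ?_))
      simp only [g, Subtype.ext_iff]
      exact ⟨fun ⟨_, h2⟩ => h2, fun h2 => ⟨fun h3 => v.2 (h2 ▸ congrArg f h3), h2⟩⟩
    -- The product of the degrees left after removing a leaf attached at `w`.
    let Q : {v // v ≠ f a} → ℕ := fun w => ∏ v : {v // v ≠ f a}, (D v - if w = v then 1 else 0)
    have hQ : ∀ w : {v // v ≠ f a}, D w * Q w = (D w - 1) * ∏ v : {v // v ≠ f a}, D v := by
      intro w
      simp only [Q]
      rw [← Finset.mul_prod_erase _ _ (Finset.mem_univ w),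
        ← Finset.mul_prod_erase _ (fun v : {v // v ≠ f a} => D v) (Finset.mem_univ w)]
      rw [Finset.prod_congr rfl (g := fun v : {v // v ≠ f a} => D v)]
      · simp
        ring
      · intro v hv
        simp [(Finset.ne_of_mem_erase hv).symm]
    -- The remaining n + 2 vertices carry 2n + 3 half-edges. The difference n + 1 is the factor that
    -- turns n! into (n + 1)!.
    have hsum : ∑ w : {v // v ≠ f a}, (D w - 1) = n + 1 := by
      have h1 : ∑ w : {v // v ≠ f a}, ((D w - 1) + 1) = 2 * n + 3 := by
        rw [← hH', ← sum_card_fiber g]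
        refine Finset.sum_congr rfl fun w _ => ?_
        rw [hg, Nat.sub_add_cancel (Nat.one_le_iff_ne_zero.2 (hf w))]
      rw [Finset.sum_add_distrib, Finset.sum_const, Finset.card_univ, ← Nat.card_eq_fintype_card,
        hV', smul_eq_mul] at h1
      omega
    have hprod : ∏ v, D v = ∏ v : {v // v ≠ f a}, D v := by
      rw [← Finset.mul_prod_erase _ _ (Finset.mem_univ (f a)), hDa, one_mul]
      exact Finset.prod_subtype _ (by simp) _
    rw [card_connectedPairing_eq_sum_removeLeaf f rfl ha, Finset.sum_congr rfl
      (g := fun b => n.factorial * Q (g b)), ← Finset.mul_sum, sum_comp_eq_sum_card_fiber]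
    · simp only [hg, smul_eq_mul, hQ]
      rw [← Finset.sum_mul, hsum, hprod, Nat.factorial_succ]
      ring
    · intro b _
      rw [ih _ hV' (card_ne_ne_eq b.2 hH)]
      refine congrArg _ (Finset.prod_congr rfl fun v _ => ?_)
      rw [card_removeLeaf_fiber f rfl ha]
      simp [g, Subtype.ext_iff, D]

/-! ### Transitivity and cycles of permutations -/

theorem pretransitive_closure_pair_iff {X : Type} (α σ : Equiv.Perm X) [Finite X] :
    MulAction.IsPretransitive (Subgroup.closure ({α, σ} : Set (Equiv.Perm X))) X ↔
      ∀ p : X → Prop, (∀ x, p x → p (α x)) → (∀ x, p x → p (σ x)) → ∀ x y, p x → p y := by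
  constructor
  · intro h p hα hσ x y hx
    obtain ⟨⟨g, hg⟩, rfl⟩ := h.exists_smul_eq x y
    have key : ∀ g ∈ Subgroup.closure ({α, σ} : Set (Equiv.Perm X)), ∀ x, p x ↔ p (g x) := by
      -- On a finite set, forward invariance under a permutation implies invariance under its
      -- inverse.
      have perm : ∀ β : Equiv.Perm X, (∀ x, p x → p (β x)) → ∀ x, p x ↔ p (β x) := fun β hβ x =>
        ⟨hβ x, fun h => by
          simpa using Equiv.Perm.perm_symm_on_of_perm_on_finite (p := p) hβ h⟩
      intro g hg
      induction hg using Subgroup.closure_induction with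
      | mem g hg =>
        rcases hg with rfl | rfl
        · exact perm _ hα
        · exact perm _ hσ
      | one => simp
      | mul g k _ _ ihg ihk => exact fun x => (ihk x).trans (ihg (k x))
      | inv g _ ih => exact fun x => by simpa using (ih (g⁻¹ x)).symm
    exact (key g hg x).1 hx
  · refine fun h => ⟨fun x y => ?_⟩
    refine h (fun y => ∃ g : Subgroup.closure ({α, σ} : Set (Equiv.Perm X)), g • x = y)
      ?_ ?_ x y ⟨1, one_smul _ _⟩
    · rintro _ ⟨g, rfl⟩
      exact ⟨⟨α, Subgroup.subset_closure (by simp)⟩ * g, rfl⟩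
    · rintro _ ⟨g, rfl⟩
      exact ⟨⟨σ, Subgroup.subset_closure (by simp)⟩ * g, rfl⟩

/-- The cycle length is the minimal period. -/
theorem card_sameCycle_eq_minimalPeriod {X : Type} [Finite X] (σ : Equiv.Perm X) (x : X) :
    Nat.card {y // σ.SameCycle x y} = Function.minimalPeriod σ x := by
  have := Fintype.ofFinite X
  classical
  have h := MulAction.minimalPeriod_eq_card (a := σ) (b := x)
  rw [← Nat.card_eq_fintype_card] at h
  refine Eq.trans (Nat.card_congr (Equiv.subtypeEquivRight fun y => ?_)) h.symm
  rw [MulAction.mem_orbit_iff]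
  constructor
  · rintro ⟨i, hi⟩
    exact ⟨⟨σ ^ i, i, rfl⟩, hi⟩
  · rintro ⟨⟨_, i, rfl⟩, hi⟩
    exact ⟨i, hi⟩

theorem sameCycle_of_intertwines {X Y : Type} {σ : Equiv.Perm X} {τ : Equiv.Perm Y} (φ : X ≃ Y)
    (h : ∀ x, φ (σ x) = τ (φ x)) {x y : X} : τ.SameCycle (φ x) (φ y) ↔ σ.SameCycle x y := by
  have h1 : ∀ i : ℤ, ∀ x, (τ ^ i) (φ x) = φ ((σ ^ i) x) := by
    have : τ = φ.permCongr σ := by ext y; simp [h]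
    intro i x
    rw [this, ← Equiv.permCongrHom_coe, ← map_zpow]
    simp 
  simp [Equiv.Perm.SameCycle, h1]

/-! ### Relabelling of half-edges -/

namespace PlaneTree

variable {e : ℕ}

@[ext]
theorem ext {Γ Γ' : PlaneTree e} (h : Γ.α = Γ'.α) (h' : Γ.σ = Γ'.σ) : Γ = Γ' := by
  cases Γ; cases Γ'; cases h; cases h'; rfl

instance : Finite (PlaneTree e) :=
  Finite.of_injective (fun Γ : PlaneTree e => (Γ.α, Γ.σ)) fun _ _ h =>
    ext (congrArg Prod.fst h) (congrArg Prod.snd h)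

/-- Isomorphic permutation pairs on another set of half-edges give a plane tree. -/
def ofEquiv {X : Type} [Finite X] (α σ : Equiv.Perm X) (φ : X ≃ Fin (2 * e))
    (hα : ∀ h, α (α h) = h) (hα' : ∀ h, α h ≠ h)
    (ht : ∀ p : X → Prop, (∀ x, p x → p (α x)) → (∀ x, p x → p (σ x)) → ∀ x y, p x → p y)
    (hc : Nat.card (Quotient (Equiv.Perm.SameCycle.setoid σ)) = 1 + e) : PlaneTree e where
  α := φ.permCongr α
  σ := φ.permCongr σ
  involutive h := by simp [hα]
  fixedPointFree h := by
    rw [Equiv.permCongr_apply, ne_eq, ← Equiv.eq_symm_apply]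
    exact hα' _
  transitive := by
    rw [pretransitive_closure_pair_iff]
    intro p h1 h2 x y hx
    have := ht (fun x => p (φ x)) (fun x hx => by simpa using h1 _ hx)
      (fun x hx => by simpa using h2 _ hx) (φ.symm x) (φ.symm y)
    simpa [hx] using this
  card_vertices := by
    rw [← hc]
    refine (Nat.card_congr (Quotient.congr φ fun x y => ?_)).symm
    exact (sameCycle_of_intertwines φ (by simp)).symm

/-- The action of the relabellings of the half-edges. -/
def relabel (φ : Equiv.Perm (Fin (2 * e))) (Γ : PlaneTree e) : PlaneTree e :=
  ofEquiv Γ.α Γ.σ φ Γ.involutive Γ.fixedPointFree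
    ((pretransitive_closure_pair_iff _ _).1 Γ.transitive) Γ.card_vertices

theorem degreeAt_eq_of_intertwines {Γ Γ' : PlaneTree e} (φ : Equiv.Perm (Fin (2 * e)))
    (h : ∀ x, φ (Γ.σ x) = Γ'.σ (φ x)) (x : Fin (2 * e)) : Γ'.degreeAt (φ x) = Γ.degreeAt x :=
  (Nat.card_congr (φ.subtypeEquiv fun _ => (sameCycle_of_intertwines φ h).symm)).symm

end PlaneTree

/-- The plane trees with `N` roots of given degrees, not up to isomorphism. -/
abbrev LabelledTree (N e : ℕ) (d : Fin N → ℕ) : Type :=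
  {t : PlaneTree e × (Fin N → Fin (2 * e)) //
    (∀ i j, i ≠ j → ¬ t.1.σ.SameCycle (t.2 i) (t.2 j)) ∧ ∀ i, t.1.degreeAt (t.2 i) = d i}

namespace LabelledTree

variable {N e : ℕ} {d : Fin N → ℕ}

/-- The isomorphism class of a labelled tree. -/
def cls (t : LabelledTree N e d) : Quotient (isoSetoid N e d) :=
  Quotient.mk _ ⟨RootedTree.ofPlaneTree t.1.1 t.1.2 t.2.1, t.2.2⟩

theorem cls_eq_iff (s t : LabelledTree N e d) : s.cls = t.cls ↔
    ∃ φ : Equiv.Perm (Fin (2 * e)), (∀ h, φ (s.1.1.α h) = t.1.1.α (φ h)) ∧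
      (∀ h, φ (s.1.1.σ h) = t.1.1.σ (φ h)) ∧ ∀ k, φ (s.1.2 k) = t.1.2 k :=
  Quotient.eq

theorem cls_surjective (he : e ≠ 0) : Function.Surjective (cls : LabelledTree N e d → _) := by
  rintro ⟨⟨t, ht⟩⟩
  cases t with
  | singleVertex _ h => exact (he h).elim
  | ofPlaneTree Γ r h => exact ⟨⟨(Γ, r), h, ht⟩, rfl⟩

/-- The action of the relabellings of the half-edges. -/
def relabel (φ : Equiv.Perm (Fin (2 * e))) (t : LabelledTree N e d) : LabelledTree N e d :=
  ⟨(t.1.1.relabel φ, φ ∘ t.1.2), fun i j hij h =>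
    t.2.1 i j hij ((sameCycle_of_intertwines φ
      (by simp [PlaneTree.relabel, PlaneTree.ofEquiv])).1 h), fun i => by
    rw [← t.2.2 i]
    exact PlaneTree.degreeAt_eq_of_intertwines φ
      (by simp [PlaneTree.relabel, PlaneTree.ofEquiv]) _⟩

/-- The set where two such relabellings agree contains a root and is stable under α and σ, so by
transitivity it is everything. -/
theorem relabel_injective (hN : 1 ≤ N) (t : LabelledTree N e d) :
    Function.Injective fun φ => t.relabel φ := by
  intro φ ψ h
  have hr : ∀ i, φ (t.1.2 i) = ψ (t.1.2 i) := congrFun (congrArg (fun s => s.1.2) h)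
  have hα : φ.permCongr t.1.1.α = ψ.permCongr t.1.1.α := congrArg (fun s => s.1.1.α) h
  have hσ : φ.permCongr t.1.1.σ = ψ.permCongr t.1.1.σ := congrArg (fun s => s.1.1.σ) h
  have key : ∀ β : Equiv.Perm (Fin (2 * e)), φ.permCongr β = ψ.permCongr β →
      ∀ x, φ x = ψ x → φ (β x) = ψ (β x) := fun β h x hx => by
    have h1 : φ.permCongr β (φ x) = ψ.permCongr β (ψ x) := by rw [h, hx]
    simpa using h1
  ext x
  rw [(pretransitive_closure_pair_iff _ _).1 t.1.1.transitive (fun x => φ x = ψ x) (key _ hα)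
    (key _ hσ) (t.1.2 ⟨0, hN⟩) x (hr _)]

/-- An isomorphism class is a single free orbit of the symmetric group on the half-edges. -/
theorem card_fiber_cls (hN : 1 ≤ N) (t : LabelledTree N e d) :
    Nat.card {s : LabelledTree N e d // s.cls = t.cls} = (2 * e).factorial := by
  rw [← Nat.card_eq_of_bijective (f := fun φ : Equiv.Perm (Fin (2 * e)) =>
    (⟨t.relabel φ, ?_⟩ : {s : LabelledTree N e d // s.cls = t.cls})), Nat.card_perm, Nat.card_fin]
  · refine ⟨fun φ ψ h => t.relabel_injective hN (congrArg Subtype.val h), fun ⟨s, hs⟩ => ?_⟩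
    obtain ⟨φ, h1, h2, h3⟩ := (cls_eq_iff _ _).1 hs.symm
    refine ⟨φ, Subtype.ext (Subtype.ext (Prod.ext (PlaneTree.ext ?_ ?_) (funext h3)))⟩
    · ext x
      simp [relabel, PlaneTree.relabel, PlaneTree.ofEquiv, h1]
    · ext x
      simp [relabel, PlaneTree.relabel, PlaneTree.ofEquiv, h2]
  · rw [eq_comm, cls_eq_iff]
    exact ⟨φ, by simp [relabel, PlaneTree.relabel, PlaneTree.ofEquiv]⟩

end LabelledTree

theorem card_labelledTree {N e : ℕ} (d : Fin N → ℕ) (hN : 1 ≤ N) (he : e ≠ 0) :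
    Nat.card (LabelledTree N e d) = (2 * e).factorial * T N e d := by
  have : Finite (Quotient (isoSetoid N e d)) :=
    Finite.of_surjective _ (LabelledTree.cls_surjective (d := d) he)
  have := Fintype.ofFinite (Quotient (isoSetoid N e d))
  rw [← Nat.card_congr (Equiv.sigmaFiberEquiv (LabelledTree.cls : LabelledTree N e d → _)),
    Nat.card_sigma, Finset.sum_congr rfl (g := fun _ => (2 * e).factorial), Finset.sum_const,
    Finset.card_univ, ← Nat.card_eq_fintype_card, smul_eq_mul, mul_comm, T]
  intro q _
  obtain ⟨t, rfl⟩ := LabelledTree.cls_surjective he q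
  exact t.card_fiber_cls hN

/-! ### Trees with all vertices rooted -/

section Rotation

variable {N : ℕ} {d : Fin N → ℕ}

/-- Rotation of every fibre of `Σ i, Fin (d i)`. -/
def rotation (d : Fin N → ℕ) : Equiv.Perm (Σ i, Fin (d i)) :=
  Equiv.sigmaCongrRight fun i => finRotate (d i)

theorem coe_finRotate_apply {n : ℕ} (k : Fin n) : (finRotate n k : ℕ) = (k + 1) % n := by
  cases n with
  | zero => exact k.elim0
  | succ n => rw [finRotate_apply, Fin.val_add, Fin.val_one', Nat.add_mod_mod]

theorem rotation_fst (x : Σ i, Fin (d i)) : (rotation d x).1 = x.1 := rfl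

theorem iterate_rotation_fst (n : ℕ) (x : Σ i, Fin (d i)) : ((rotation d)^[n] x).1 = x.1 := by
  induction n with
  | zero => rfl
  | succ n ih => rw [Function.iterate_succ_apply', rotation_fst, ih]

theorem iterate_rotation (hd : ∀ i, 0 < d i) (i : Fin N) (n : ℕ) (hn : n < d i) :
    (rotation d)^[n] ⟨i, ⟨0, hd i⟩⟩ = ⟨i, ⟨n, hn⟩⟩ := by
  induction n with
  | zero => rfl
  | succ n ih =>
    rw [Function.iterate_succ_apply', ih (by omega)]
    exact congrArg (Sigma.mk i) (Fin.ext ((coe_finRotate_apply _).trans (Nat.mod_eq_of_lt hn)))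

theorem sameCycle_rotation_iff (hd : ∀ i, 0 < d i) {x y : Σ i, Fin (d i)} :
    (rotation d).SameCycle x y ↔ x.1 = y.1 := by
  constructor
  · intro h
    obtain ⟨n, rfl⟩ := h.exists_nat_pow_eq
    rw [← Equiv.Perm.iterate_eq_pow, iterate_rotation_fst]
  · have key : ∀ x : Σ i, Fin (d i), (rotation d).SameCycle ⟨x.1, ⟨0, hd x.1⟩⟩ x := fun x =>
      ⟨(x.2 : ℕ), by
        rw [zpow_natCast, ← Equiv.Perm.iterate_eq_pow]
        exact iterate_rotation hd x.1 x.2 x.2.2⟩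
    intro h
    refine (key x).symm.trans ?_
    obtain ⟨i, k⟩ := x
    obtain ⟨j, l⟩ := y
    obtain rfl : i = j := h
    exact key ⟨i, l⟩

theorem card_cycles_rotation (hd : ∀ i, 0 < d i) :
    Nat.card (Quotient (Equiv.Perm.SameCycle.setoid (rotation d))) = N := by
  refine (Nat.card_eq_of_bijective (Quotient.lift Sigma.fst fun x y h =>
    (sameCycle_rotation_iff hd).1 h) ⟨?_, fun i => ⟨⟦⟨i, ⟨0, hd i⟩⟩⟧, rfl⟩⟩).trans (Nat.card_fin N)
  rintro ⟨x⟩ ⟨y⟩ h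
  exact Quotient.sound ((sameCycle_rotation_iff hd).2 h)

theorem card_sigma_fst_fiber (i : Fin N) :
    Nat.card {x : Σ i, Fin (d i) // x.1 = i} = d i := by
  rw [Nat.card_congr (Equiv.sigmaSubtype i), Nat.card_fin]

end Rotation

namespace LabelledTree

variable {N e : ℕ} {d : Fin N → ℕ}

/-- The `k`-th half-edge after the root on the `i`-th root vertex. -/
def halfEdge (t : LabelledTree N e d) (x : Σ i, Fin (d i)) : Fin (2 * e) :=
  t.1.1.σ^[x.2] (t.1.2 x.1)

theorem minimalPeriod_root (t : LabelledTree N e d) (i : Fin N) :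
    Function.minimalPeriod t.1.1.σ (t.1.2 i) = d i := by
  rw [← t.2.2 i, ← card_sameCycle_eq_minimalPeriod]
  rfl

theorem halfEdge_rotation (t : LabelledTree N e d) (x : Σ i, Fin (d i)) :
    t.halfEdge (rotation d x) = t.1.1.σ (t.halfEdge x) := by
  change t.1.1.σ^[(finRotate (d x.1) x.2 : ℕ)] (t.1.2 x.1) = t.1.1.σ (t.1.1.σ^[x.2] (t.1.2 x.1))
  -- Handles the wrap-around from the last half-edge of a vertex to its root.
  have := Function.iterate_mod_minimalPeriod_eq (f := t.1.1.σ) (x := t.1.2 x.1) (n := x.2 + 1)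
  rw [t.minimalPeriod_root] at this
  rw [coe_finRotate_apply, this, Function.iterate_succ_apply']

theorem sameCycle_halfEdge (t : LabelledTree N e d) (x : Σ i, Fin (d i)) :
    t.1.1.σ.SameCycle (t.1.2 x.1) (t.halfEdge x) :=
  ⟨(x.2 : ℕ), by rw [zpow_natCast, ← Equiv.Perm.iterate_eq_pow]; rfl⟩

theorem halfEdge_injective (t : LabelledTree N e d) : Function.Injective t.halfEdge := by
  intro x y h
  have h1 : x.1 = y.1 := by
    by_contra hne
    exact t.2.1 _ _ hne ((t.sameCycle_halfEdge x).trans (h ▸ (t.sameCycle_halfEdge y).symm))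
  obtain ⟨i, k⟩ := x
  obtain ⟨j, l⟩ := y
  obtain rfl : i = j := h1
  have := Function.iterate_injOn_Iio_minimalPeriod (f := t.1.1.σ) (x := t.1.2 i)
    (by rw [t.minimalPeriod_root]; exact k.2) (by rw [t.minimalPeriod_root]; exact l.2) h
  exact congrArg (Sigma.mk i) (Fin.ext this)

/-- The vertex of a half-edge. -/
def vertex (t : LabelledTree N e d) (h : Fin (2 * e)) :
    Quotient (Equiv.Perm.SameCycle.setoid t.1.1.σ) :=
  Quotient.mk _ h

theorem vertex_eq_iff (t : LabelledTree N e d) {x y : Fin (2 * e)} :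
    t.vertex x = t.vertex y ↔ t.1.1.σ.SameCycle x y :=
  Quotient.eq

theorem vertex_root_injective (t : LabelledTree N e d) :
    Function.Injective fun i => t.vertex (t.1.2 i) := fun i j h => by
  by_contra hne
  exact t.2.1 i j hne (t.vertex_eq_iff.1 h)

theorem halfEdge_bijective {d : Fin (e + 1) → ℕ} (t : LabelledTree (e + 1) e d) :
    Function.Bijective t.halfEdge := by
  refine ⟨t.halfEdge_injective, fun h => ?_⟩
  -- Distinct root vertices, as many as there are vertices, exhaust them.
  have hb := (Nat.bijective_iff_injective_and_card fun i => t.vertex (t.1.2 i)).2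
    ⟨t.vertex_root_injective, by rw [Nat.card_fin, t.1.1.card_vertices, add_comm]⟩
  obtain ⟨i, hi⟩ := hb.2 (t.vertex h)
  obtain ⟨n, hn⟩ := (t.vertex_eq_iff.1 hi).exists_nat_pow_eq
  have hd : 0 < d i := by
    rw [← t.2.2 i]
    have : Nonempty {h' // t.1.1.σ.SameCycle (t.1.2 i) h'} := ⟨⟨_, Equiv.Perm.SameCycle.refl _ _⟩⟩
    exact Nat.card_pos
  refine ⟨⟨i, ⟨n % d i, Nat.mod_lt _ hd⟩⟩, ?_⟩
  rw [← hn, ← Equiv.Perm.iterate_eq_pow]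
  change t.1.1.σ^[n % d i] (t.1.2 i) = _
  rw [← t.minimalPeriod_root, Function.iterate_mod_minimalPeriod_eq]

theorem sum_degree_eq {d : Fin (e + 1) → ℕ} (t : LabelledTree (e + 1) e d) :
    ∑ i, d i = 2 * e := by
  have := Nat.card_eq_of_bijective _ t.halfEdge_bijective
  simpa [Nat.card_sigma] using this

theorem map_halfEdge {s t : LabelledTree N e d} {φ : Equiv.Perm (Fin (2 * e))}
    (hσ : ∀ h, φ (s.1.1.σ h) = t.1.1.σ (φ h)) (hr : ∀ k, φ (s.1.2 k) = t.1.2 k)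
    (x : Σ i, Fin (d i)) : φ (s.halfEdge x) = t.halfEdge x := by
  have : Function.Semiconj φ s.1.1.σ t.1.1.σ := hσ
  rw [halfEdge, this.iterate_right, hr, halfEdge]

/-- The tree with the standard rotation and the edges given by a connected pairing. -/
def ofPairing {d : Fin (e + 1) → ℕ} (hd : ∀ i, 0 < d i) (φ : (Σ i, Fin (d i)) ≃ Fin (2 * e))
    (α : {α // IsConnectedPairing (Sigma.fst : (Σ i, Fin (d i)) → Fin (e + 1)) α}) :
    LabelledTree (e + 1) e d :=
  ⟨(PlaneTree.ofEquiv (Function.Involutive.toPerm α.1 α.2.involutive) (rotation d) φ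
    α.2.involutive α.2.ne_self (by
      intro p h1 h2 x y hx
      have key : ∀ x y : Σ i, Fin (d i), x.1 = y.1 → p x → p y := by
        intro x y hxy hx
        obtain ⟨n, rfl⟩ := ((sameCycle_rotation_iff hd).2 hxy).exists_nat_pow_eq
        rw [← Equiv.Perm.iterate_eq_pow]
        clear hxy
        induction n with
        | zero => exact hx
        | succ n ih =>
          rw [Function.iterate_succ_apply']
          exact h2 _ ih
      -- The pairing moves `p` between the base half-edges of the vertices, and rotation spreads it
      -- within each vertex.
      refine key ⟨y.1, ⟨0, hd _⟩⟩ _ rfl (α.2.connected (fun v => p ⟨v, ⟨0, hd v⟩⟩) ?_ x.1 y.1 ?_)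
      · exact fun h hh => key (α.1 h) _ rfl (h1 h (key _ h (by rfl) hh))
      · exact key _ _ (by rfl) hx)
    (by rw [card_cycles_rotation hd, add_comm]), fun i => φ ⟨i, ⟨0, hd i⟩⟩), fun i j hij h => by
      have h := (sameCycle_of_intertwines (σ := rotation d) φ (by simp [PlaneTree.ofEquiv])).1 h
      exact hij ((sameCycle_rotation_iff hd).1 h), fun i => by
      rw [← card_sigma_fst_fiber (d := d) i]
      refine (Nat.card_congr (φ.subtypeEquiv fun x => ?_)).symm
      rw [sameCycle_of_intertwines (σ := rotation d) φ (by simp [PlaneTree.ofEquiv]),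
        sameCycle_rotation_iff hd, eq_comm]⟩

theorem halfEdge_ofPairing {d : Fin (e + 1) → ℕ} (hd : ∀ i, 0 < d i)
    (φ : (Σ i, Fin (d i)) ≃ Fin (2 * e)) (α) (x : Σ i, Fin (d i)) :
    (ofPairing hd φ α).halfEdge x = φ x := by
  have h : Function.Semiconj φ (rotation d) (φ.permCongr (rotation d)) := fun x => by simp
  change (φ.permCongr (rotation d))^[x.2] (φ ⟨x.1, ⟨0, hd x.1⟩⟩) = φ x
  rw [← h.iterate_right, iterate_rotation hd x.1 x.2 x.2.2]

/-- The edges of a tree all of whose vertices are rooted form a connected pairing. -/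
theorem exists_pairing {d : Fin (e + 1) → ℕ} (hd : ∀ i, 0 < d i) (t : LabelledTree (e + 1) e d) :
    ∃ α, IsConnectedPairing (Sigma.fst : (Σ i, Fin (d i)) → Fin (e + 1)) α ∧
      ∀ x, t.halfEdge (α x) = t.1.1.α (t.halfEdge x) := by
  let Φ := Equiv.ofBijective _ t.halfEdge_bijective
  have hΦ : ∀ x, Φ x = t.halfEdge x := fun _ => rfl
  have hα : ∀ x, t.halfEdge (Φ.symm (t.1.1.α (Φ x))) = t.1.1.α (t.halfEdge x) := fun x => by
    rw [← hΦ, Equiv.apply_symm_apply, hΦ]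
  refine ⟨fun x => Φ.symm (t.1.1.α (Φ x)), ⟨fun x => ?_, fun x h => ?_, fun p hp u v hu => ?_⟩, hα⟩
  · simp [t.1.1.involutive]
  · rw [Equiv.symm_apply_eq] at h
    exact t.1.1.fixedPointFree _ h
  · have := (pretransitive_closure_pair_iff _ _).1 t.1.1.transitive (fun h => p (Φ.symm h).1)
      (fun h hh => by simpa using hp (Φ.symm h) hh) (fun h hh => ?_)
      (Φ ⟨u, ⟨0, hd u⟩⟩) (Φ ⟨v, ⟨0, hd v⟩⟩) (by simpa using hu)
    · simpa using this
    · have : Φ.symm (t.1.1.σ h) = rotation d (Φ.symm h) := by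
        rw [Equiv.symm_apply_eq, hΦ, halfEdge_rotation, ← hΦ, Equiv.apply_symm_apply]
      rw [this]
      exact hh

theorem cls_ofPairing_bijective {d : Fin (e + 1) → ℕ} (hd : ∀ i, 0 < d i) (he : e ≠ 0)
    (φ : (Σ i, Fin (d i)) ≃ Fin (2 * e)) :
    Function.Bijective fun α => (ofPairing hd φ α).cls := by
  constructor
  · intro α β h
    obtain ⟨ψ, h1, h2, h3⟩ := (cls_eq_iff _ _).1 h
    -- An isomorphism respects σ and the roots, hence the canonical names; both trees use the same
    -- names `φ`, so it is the identity.
    have hψ : ∀ x, ψ x = x := fun x => by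
      have := map_halfEdge h2 h3 (φ.symm x)
      simpa [halfEdge_ofPairing] using this
    refine Subtype.ext (funext fun x => φ.injective ?_)
    have := h1 (φ x)
    simp only [hψ, ofPairing, PlaneTree.ofEquiv, Equiv.permCongr_apply,
      Equiv.symm_apply_apply] at this
    exact this
  · intro q
    obtain ⟨t, rfl⟩ := cls_surjective he q
    obtain ⟨α, hα, h⟩ := t.exists_pairing hd
    refine ⟨⟨α, hα⟩, (cls_eq_iff _ _).2
      ⟨φ.symm.trans (Equiv.ofBijective _ t.halfEdge_bijective), fun x => ?_, fun x => ?_,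
        fun k => ?_⟩⟩
    · simp only [ofPairing, PlaneTree.ofEquiv, Equiv.permCongr_apply, Equiv.trans_apply,
        Equiv.symm_apply_apply, Equiv.ofBijective_apply]
      exact h _
    · simp [ofPairing, PlaneTree.ofEquiv, halfEdge_rotation]
    · simp [ofPairing, halfEdge]

end LabelledTree

/-- The number of plane trees all of whose vertices are rooted. -/
theorem T_succ_self {e : ℕ} (he : e ≠ 0) {d : Fin (e + 1) → ℕ} (hd : ∀ i, 0 < d i) :
    T (e + 1) e d = if ∑ i, d i = 2 * e then (e - 1).factorial * ∏ i, d i else 0 := by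
  split_ifs with h
  · have hc : Nat.card (Σ i, Fin (d i)) = 2 * e := by simp [h]
    rw [T, ← Nat.card_eq_of_bijective _ (LabelledTree.cls_ofPairing_bijective hd he
      (Finite.equivFinOfCardEq hc)), card_connectedPairing (e - 1) _ (by simp; omega)
        (by rw [hc]; omega)]
    simp only [card_sigma_fst_fiber]
  · by_contra h0
    obtain ⟨q⟩ := (Nat.card_ne_zero.1 h0).1
    obtain ⟨t, -⟩ := LabelledTree.cls_surjective he q
    exact h t.sum_degree_eq

/-! ### Adding a root -/

theorem sum_inv_card_fiber {H V : Type} [Fintype H] [Fintype V] (f : H → V)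
    (hf : Function.Surjective f) (p : V → Prop) [DecidablePred p] :
    ∑ h, (if p (f h) then (Nat.card {h' // f h' = f h} : ℚ)⁻¹ else 0) = Nat.card {v // p v} := by
  rw [sum_comp_eq_sum_card_fiber f fun v => if p v then (Nat.card {h' // f h' = v} : ℚ)⁻¹ else 0,
    Nat.card_eq_fintype_card, Fintype.card_subtype, Finset.card_filter, Nat.cast_sum]
  refine Finset.sum_congr rfl fun v _ => ?_
  obtain ⟨h, hh⟩ := hf v
  have : Nonempty {h // f h = v} := ⟨⟨h, hh⟩⟩
  have : (Nat.card {h // f h = v} : ℚ) ≠ 0 := Nat.cast_ne_zero.2 Nat.card_pos.ne'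
  split_ifs
  · rw [nsmul_eq_mul, mul_inv_cancel₀ this, Nat.cast_one]
  · simp

theorem card_not_mem_range {N n : ℕ} {V : Type} [Finite V] (hV : Nat.card V = n) {g : Fin N → V}
    (hg : Function.Injective g) : Nat.card {v // ∀ i, g i ≠ v} + N = n := by
  classical
  have := Fintype.ofFinite V
  have h := Fintype.card_subtype_compl (fun v => v ∈ Set.range g)
  have h1 : Fintype.card {v // v ∈ Set.range g} = N := by
    rw [← Nat.card_eq_fintype_card]
    exact (Nat.card_congr (Equiv.ofInjective g hg)).symm.trans (Nat.card_fin N)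
  have h2 : N ≤ n := by
    rw [← hV, ← Nat.card_fin N]
    exact Nat.card_le_card_of_injective g hg
  rw [h1, ← Nat.card_eq_fintype_card, ← Nat.card_eq_fintype_card, hV] at h
  rw [Nat.card_congr (Equiv.subtypeEquivRight (q := fun v => v ∉ Set.range g) (by simp)), h]
  omega

namespace LabelledTree

variable {N e : ℕ} {d : Fin N → ℕ}

/-- The half-edges of degree `k` which can serve as another root. -/
abbrev NextRoot (t : LabelledTree N e d) (k : ℕ) : Type :=
  {h // (∀ i, t.vertex (t.1.2 i) ≠ t.vertex h) ∧ t.1.1.degreeAt h = k}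

/-- Adding a root. -/
def addRoot (k : ℕ) (s : Σ t : LabelledTree N e d, t.NextRoot k) :
    LabelledTree (N + 1) e (Fin.cons k d : Fin (N + 1) → ℕ) :=
  ⟨(s.1.1.1, Fin.cons s.2.1 s.1.1.2), by
    obtain ⟨⟨⟨Γ, r⟩, h1, h2⟩, h, h3, h4⟩ := s
    refine ⟨fun i j hij => ?_, fun i => ?_⟩
    · have h3' : ∀ i, ¬ Γ.σ.SameCycle (r i) h := fun i hi => h3 i (Quotient.sound hi)
      cases i using Fin.cases <;> cases j using Fin.cases
      · exact (hij rfl).elim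
      · exact fun h => h3' _ h.symm
      · exact h3' _
      · exact h1 _ _ fun h => hij (congrArg _ h)
    · cases i using Fin.cases
      · exact h4
      · exact h2 _⟩

theorem addRoot_bijective (k : ℕ) :
    Function.Bijective (addRoot k : (Σ t : LabelledTree N e d, t.NextRoot k) → _) := by
  constructor
  · rintro ⟨⟨⟨Γ, r⟩, h1⟩, h, h2⟩ ⟨⟨⟨Γ', r'⟩, h1'⟩, h', h2'⟩ heq
    replace heq := congrArg Subtype.val heq
    simp only [addRoot, Prod.mk.injEq] at heq
    obtain ⟨rfl, hr⟩ := heq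
    obtain ⟨rfl, rfl⟩ := Fin.cons_inj.1 hr
    rfl
  · rintro ⟨⟨Γ, r⟩, h1, h2⟩
    refine ⟨⟨⟨(Γ, Fin.tail r), fun i j hij => h1 _ _ fun h => hij (Fin.succ_injective _ h),
      fun i => h2 i.succ⟩, r 0, fun i h => ?_, h2 0⟩, ?_⟩
    · exact h1 i.succ 0 (Fin.succ_ne_zero i) (Quotient.exact h)
    · exact Subtype.ext (Prod.ext rfl (Fin.cons_self_tail r))

/-- Each unrooted vertex of degree k offers k half-edges of weight 1/k, so it contributes 1 to the
sum. -/
theorem sum_card_nextRoot (t : LabelledTree N e d) :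
    ∑ k ∈ Finset.Icc 1 (2 * e), (Nat.card (t.NextRoot k) : ℚ) / k + N = e + 1 := by
  classical
  have := Fintype.ofFinite (Quotient (Equiv.Perm.SameCycle.setoid t.1.1.σ))
  have hdeg : ∀ h, Nat.card {h' // t.vertex h' = t.vertex h} = t.1.1.degreeAt h := fun h =>
    Nat.card_congr (Equiv.subtypeEquivRight fun h' => by
      rw [t.vertex_eq_iff, Equiv.Perm.sameCycle_comm])
  have h1 := sum_inv_card_fiber t.vertex Quotient.mk_surjective
    fun v => ∀ i, t.vertex (t.1.2 i) ≠ v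
  have h2 := card_not_mem_range t.1.1.card_vertices t.vertex_root_injective
  simp only [hdeg] at h1
  have h3 : ((e : ℚ) + 1) = ((1 + e : ℕ) : ℚ) := by push_cast; ring
  rw [h3, ← h2, Nat.cast_add, ← h1, ← Finset.sum_filter,
    ← Finset.sum_fiberwise_of_maps_to (t := Finset.Icc 1 (2 * e)) (g := t.1.1.degreeAt)]
  · congr 1
    refine Finset.sum_congr rfl fun k _ => ?_
    rw [Finset.sum_congr rfl (g := fun _ => (k : ℚ)⁻¹) (by simp +contextual), Finset.sum_const,
      Finset.filter_filter, ← Fintype.card_subtype, ← Nat.card_eq_fintype_card, nsmul_eq_mul,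
      div_eq_mul_inv]
  · intro h _
    have : Nonempty {h' // t.1.1.σ.SameCycle h h'} := ⟨⟨h, Equiv.Perm.SameCycle.refl _ _⟩⟩
    refine Finset.mem_Icc.2 ⟨Nat.card_pos, ?_⟩
    exact (Finite.card_subtype_le _).trans_eq (Nat.card_fin _)

end LabelledTree

theorem sum_card_labelledTree_cons (N e : ℕ) (d : Fin N → ℕ) :
    ∑ k ∈ Finset.Icc 1 (2 * e),
        (Nat.card (LabelledTree (N + 1) e (Fin.cons k d : Fin (N + 1) → ℕ)) : ℚ) / k =
      (e + 1 - N) * Nat.card (LabelledTree N e d) := by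
  have := Fintype.ofFinite (LabelledTree N e d)
  have h : ∀ k, (Nat.card (LabelledTree (N + 1) e (Fin.cons k d : Fin (N + 1) → ℕ)) : ℚ) / k =
      ∑ t : LabelledTree N e d, (Nat.card (t.NextRoot k) : ℚ) / k := fun k => by
    rw [← Nat.card_eq_of_bijective _ (LabelledTree.addRoot_bijective k), Nat.card_sigma,
      Nat.cast_sum, Finset.sum_div]
  rw [Finset.sum_congr rfl fun k _ => h k, Finset.sum_comm,
    Finset.sum_congr rfl fun t _ => eq_sub_of_add_eq t.sum_card_nextRoot, Finset.sum_const,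
    Finset.card_univ, ← Nat.card_eq_fintype_card, nsmul_eq_mul, mul_comm]

/-! ### Compositions and descent in the number of roots -/

/-- The number of compositions of `s` into `m` positive parts. -/
def compositions : ℕ → ℕ → ℕ
  | 0, 0 => 1
  | 0, _ + 1 => 0
  | _ + 1, 0 => 0
  | m + 1, s + 1 => s.choose m

theorem sum_range_compositions (m s : ℕ) :
    ∑ j ∈ Finset.range s, compositions m j = compositions (m + 1) s := by
  induction s with
  | zero => rfl
  | succ s ih =>
    rw [Finset.sum_range_succ, ih]
    cases m <;> cases s <;> simp [compositions, Nat.choose_succ_succ, add_comm]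

/-- The first part `k` is split off. The guards keep truncated subtraction from producing a spurious
composition of 0. -/
theorem sum_Icc_compositions (m n S : ℕ) :
    ∑ k ∈ Finset.Icc 1 n, (if k + S ≤ n then compositions m (n - (k + S)) else 0) =
      if S ≤ n then compositions (m + 1) (n - S) else 0 := by
  split_ifs with h
  · rw [← Finset.sum_filter, ← sum_range_compositions]
    refine Finset.sum_nbij' (fun k => n - (k + S)) (fun j => n - S - j) ?_ ?_ ?_ ?_ ?_ <;>
      simp <;> omega
  · exact Finset.sum_eq_zero fun k _ => if_neg (by omega)

theorem factorial_mul_card_labelledTree {e : ℕ} (he : e ≠ 0) (m : ℕ) :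
    ∀ (N : ℕ) (d : Fin N → ℕ), 1 ≤ N → N + m = e + 1 → (∀ i, 0 < d i) →
      (m.factorial * Nat.card (LabelledTree N e d) : ℚ) =
        (2 * e).factorial * ((e - 1).factorial * (∏ i, (d i : ℚ)) *
          (if ∑ i, d i ≤ 2 * e then compositions m (2 * e - ∑ i, d i) else 0 : ℕ)) := by
  induction m with
  | zero =>
    intro N d hN hm hd
    obtain rfl : N = e + 1 := hm
    rw [card_labelledTree d hN he, T_succ_self he hd]
    -- Only ∑ dᵢ = 2e survives: below it a positive number has no composition into zero parts, and
    -- above it the guard gives 0.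
    rcases lt_trichotomy (∑ i, d i) (2 * e) with h | h | h
    · obtain ⟨s, hs⟩ : ∃ s, 2 * e - ∑ i, d i = s + 1 := ⟨2 * e - ∑ i, d i - 1, by omega⟩
      simp [h.ne, h.le, hs, compositions]
    · simp [h, compositions]
    · simp [h.ne', h.not_ge]
  | succ m ih =>
    intro N d hN hm hd
    have hN' : (e : ℚ) + 1 - N = (m + 1 : ℕ) := by
      rw [sub_eq_iff_eq_add]
      exact_mod_cast (by omega : e + 1 = m + 1 + N)
    have h := sum_card_labelledTree_cons N e d
    rw [hN'] at h
    rw [Nat.factorial_succ, Nat.cast_mul, mul_comm ((m + 1 : ℕ) : ℚ), mul_assoc, ← h,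
      Finset.mul_sum, ← sum_Icc_compositions, Nat.cast_sum, Finset.mul_sum, Finset.mul_sum]
    refine Finset.sum_congr rfl fun k hk => ?_
    have hk : 0 < k := (Finset.mem_Icc.1 hk).1
    have hk0 : (k : ℚ) ≠ 0 := Nat.cast_ne_zero.2 hk.ne'
    rw [← mul_div_assoc, ih (N + 1) (Fin.cons k d) (by omega) (by omega)
      (Fin.cases hk hd)]
    simp only [Fin.prod_univ_succ, Fin.sum_univ_succ, Fin.cons_zero, Fin.cons_succ]
    -- The factor `k` contributed by the new root to the product cancels the weight 1/k.
    field_simp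

theorem factorial_mul_T {N e : ℕ} (he : e ≠ 0) (d : Fin N → ℕ) (m : ℕ) (hN : 1 ≤ N)
    (hm : N + m = e + 1) (hd : ∀ i, 0 < d i) (hS : ∑ i, d i ≤ 2 * e) :
    (m.factorial * T N e d : ℚ) =
      (e - 1).factorial * (∏ i, (d i : ℚ)) * compositions m (2 * e - ∑ i, d i) := by
  have h := factorial_mul_card_labelledTree he m N d hN hm hd
  rw [card_labelledTree d hN he, if_pos hS, Nat.cast_mul, mul_left_comm] at h
  exact mul_left_cancel₀ (Nat.cast_ne_zero.2 (Nat.factorial_ne_zero _)) h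

/-! ### Binomial form and the edgeless tree -/

theorem compositions_eq_binom {N e m S : ℕ} (hm : N + m = e + 1) (hS : S ≤ e + N - 1)
    (h : N = e + 1 ↔ S = 2 * e) (he : e ≠ 0) :
    (compositions m (2 * e - S) : ℤ) = binom (2 * (e : ℤ) - 1 - S) ((e : ℤ) - N) := by
  cases m with
  | zero =>
    obtain rfl : N = e + 1 := hm
    obtain rfl := h.1 rfl
    -- The empty composition of 0 matches the convention C(-1, -1) = 1.
    simp [compositions, binom]
  | succ m =>
    -- Here N ≤ e, so `hS` forces S < 2e and the upper entry `s` is a natural number.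
    obtain ⟨s, hs⟩ : ∃ s, 2 * e - S = s + 1 := ⟨2 * e - S - 1, by omega⟩
    have h1 : 2 * (e : ℤ) - 1 - S = s := by omega
    have h2 : (e : ℤ) - N = m := by omega
    rw [hs, h1, h2, binom, if_pos (Int.natCast_nonneg m), Int.toNat_natCast, Ring.choose_natCast]
    rfl

theorem not_ofPlaneTree_zero (Γ : PlaneTree 0) : False := by
  have h := Γ.card_vertices
  have : IsEmpty (Quotient (Equiv.Perm.SameCycle.setoid Γ.σ)) :=
    ⟨fun q => Quotient.inductionOn q fun x => Fin.elim0 x⟩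
  rw [Nat.card_of_isEmpty] at h
  omega

theorem T_one_zero : T 1 0 (fun _ => 0) = 1 := by
  have h : ∀ t : RootedTree 1 0, t = .singleVertex rfl rfl := fun t => by
    cases t with
    | singleVertex => rfl
    | ofPlaneTree Γ => exact (not_ofPlaneTree_zero Γ).elim
  refine Nat.card_eq_one_iff_exists.2
    ⟨Quotient.mk _ ⟨.singleVertex rfl rfl, fun _ => rfl⟩, ?_⟩
  rintro ⟨t, ht⟩
  obtain rfl := h t
  rfl

theorem eq_one_of_T_zero_ne_zero {N : ℕ} {d : Fin N → ℕ} (h : T N 0 d ≠ 0) :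
    N = 1 ∧ ∀ i, d i = 0 := by
  obtain ⟨⟨t, ht⟩⟩ := (Nat.card_ne_zero.1 h).1
  cases t with
  | singleVertex hN => exact ⟨hN, fun i => (ht i).symm⟩
  | ofPlaneTree Γ => exact (not_ofPlaneTree_zero Γ).elim

end MultiRooted

theorem theorem3 :
    (∀ (N e : ℕ) (d : Fin N → ℕ), 1 ≤ N → e ≠ 0 →
      N ≤ e + 1 →
      (∀ i, 0 < d i) →
      ∑ i, d i ≤ e + N - 1 →
      (N = e + 1 ↔ ∑ i, d i = 2 * e) →
        (MultiRooted.T N e d : ℚ) =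
          ((Nat.factorial (e - 1) : ℚ) / (Nat.factorial (e + 1 - N) : ℚ)) *
            (MultiRooted.binom (2 * (e : ℤ) - 1 - ∑ i, (d i : ℤ)) ((e : ℤ) - (N : ℤ)) : ℚ) *
            ∏ j, (d j : ℚ)) ∧
    MultiRooted.T 1 0 (fun _ => 0) = 1 ∧
    (∀ (N : ℕ) (d : Fin N → ℕ), 1 ≤ N → MultiRooted.T N 0 d ≠ 0 → N = 1 ∧ ∀ i, d i = 0) := by
  refine ⟨fun N e d hN he hNe hd hS h => ?_, MultiRooted.T_one_zero,
    fun N d _ => MultiRooted.eq_one_of_T_zero_ne_zero⟩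
  have hm : N + (e + 1 - N) = e + 1 := by omega
  have h1 := MultiRooted.factorial_mul_T he d _ hN hm hd (by omega)
  have h2 := MultiRooted.compositions_eq_binom hm hS h he
  rw [Nat.cast_sum] at h2
  have hf : ((e + 1 - N).factorial : ℚ) ≠ 0 := Nat.cast_ne_zero.2 (Nat.factorial_ne_zero _)
  rw [← h2, Int.cast_natCast]
  field_simp
  rw [mul_comm, h1]
  ring
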